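/- **Setting.** Regard $\mathbb Z^2$ as the graph whose edges join points at Euclidean distance $1$, with graph distance $d$; for $W\subseteq\mathbb Z^2$ let $\partial W=\{v\notin W: v \text{ is adjacent to some } u\in W\}$. A $q$-spin system on $\mathbb Z^2$ is given by a field $b:[q]\to[0,\infty)$ and a symmetric matrix $A:[q]\times[q]\to[0,\infty)$. It is *soft* if there are $\alpha>0$ and a spin $i$ with $b(i)>0$ such that $A(i,j)>\alpha$ for all $j\in[q]$. A partial configuration $\tau\in[q]^T$ on $T\subseteq\mathbb Z^2$ is *feasible* if it extends to some $\sigma\in[q]^{\mathbb Z^2}$ with $b(\sigma_v)>0$ for all vertices $v$ and $A(\sigma_u,\sigma_v)>0$ for all edges $\{u,v\}$. For a finite set $\Lambda\subset\mathbb Z^2$, the Gibbs distribution on $\Lambda$ with boundary condition $\tau$ outside $\Lambda$ gives to each configuration $\sigma$ that equals $\tau$ outside $\Lambda$ a probability proportional to $$\prod_{v\in\Lambda}b(\sigma_v)\prod_{\{u,v\}\text{ an edge},\ \{u,v\}\cap\Lambda\neq\emptyset}A(\sigma_u,\sigma_v);$$ it depends only on the values of $\tau$ on $\partial\Lambda$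 (apart from the fixed spins of $\sigma$ outside $\Lambda$). For $\tau\in[q]^W$, $\mu_U^\tau$ denotes the marginal on $U$ of the distribution conditioned on $\tau$. If $\mathbb Z^2\setminus W$ is finite and $U\subseteq\mathbb Z^2\setminus W$, this is the marginal on $U$ of the Gibbs distribution on $\mathbb Z^2\setminus W$ with boundary condition $\tau$. If $S$ is a finite set, $\partial S\subseteq T$, $\tau\in[q]^T$ and $U\subseteq S$, then $\mu_U^\tau$ is the marginal on $U$ of the Gibbs distribution on $S\setminus T$ with boundary condition $\tau$, the spins on $U\cap T$ being those of $\tau$. The system exhibits *weak spatial mixing with constants* $C,\gamma>0$ if for every $W\subseteq\mathbb Z^2$ with finite complement, every $U\subseteq\mathbb Z^2\setminus W$ and all feasible $\tau^1\neq\tau^2$ in $[q]^W$, $$d_{\mathrm{TV}}\bigl(\mu_U^{\tau^1},\mu_U^{\tau^2}\bigr)\le\sum_{u\in U,\,w\in W}Ce^{-\gamma d(u,w)}.$$ For $c\in\mathbb Z^2$ and an integer $L\ge1$, the square of side length $2L$ with corner $c$ is $S=\{c+(a,b):a,b\in\mathbb Z,\ 0<a,b<2L\}$. Its bisected boundary $\boxplus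 S$ consists of $\partial S$ together with the points $c+(a,b)\in S$ such that $a=L$ or $b=L$. **Proposition 3.2.** Let a soft $q$-spin system on $\mathbb Z^2$ exhibit weak spatial mixing with constants $C,\gamma>0$. Then there exist $L_0\in\mathbb N$ and $\gamma_0>0$ such that for all integers $L>L_0$, all squares $S\subset\mathbb Z^2$ of side length $2L$, all $y\in\partial S$, all $T$ with $\partial S\subseteq T\subseteq\boxplus S$, and all feasible $\tau,\tau'\in[q]^T$ that agree except possibly at the vertex $y$, $$d_{\mathrm{TV}}\bigl(\mu_Q^{\tau},\mu_Q^{\tau'}\bigr)\le e^{-\gamma_0L^{1/4}},\qquad\text{where } Q=\{x\in S:\|x-y\|\ge L^{1/2}\}$$ and $\|\cdot\|$ is the Euclidean norm. -/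

import Mathlib

noncomputable section

namespace GridSpin

/-- Vertices of the two-dimensional integer lattice. -/
abbrev Vertex : Type := ℤ × ℤ

/-- Euclidean distance between lattice points. -/
def euclDist (x y : Vertex) : ℝ :=
  Real.sqrt (((x.1 : ℝ) - y.1) ^ 2 + ((x.2 : ℝ) - y.2) ^ 2)

/-- The grid graph on `ℤ²`: edges join the vertices at Euclidean distance one
(equivalently, at squared distance one). -/
def grid : SimpleGraph Vertex where
  Adj u v := (u.1 - v.1) ^ 2 + (u.2 - v.2) ^ 2 = 1
  symm := ⟨fun u v h => by
    have e : (v.1 - u.1) ^ 2 + (v.2 - u.2) ^ 2 = (u.1 - v.1) ^ 2 + (u.2 - v.2) ^ 2 := by ring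
    rw [e]; exact h⟩
  loopless := ⟨fun u h => by simp at h⟩

/-- The (outer vertex) boundary of a set of vertices. -/
def boundary (W : Set Vertex) : Set Vertex :=
  {v | v ∉ W ∧ ∃ u ∈ W, grid.Adj u v}

/-- The finite set of edges of the grid having at least one endpoint in `Λ`
(see `mem_edgesTouching`). -/
def edgesTouching (Λ : Finset Vertex) : Finset (Sym2 Vertex) :=
  Λ.biUnion fun v =>
    {s(v, (v.1 + 1, v.2)), s(v, (v.1 - 1, v.2)), s(v, (v.1, v.2 + 1)), s(v, (v.1, v.2 - 1))}

theorem grid_adj_iff (u v : Vertex) :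
    grid.Adj u v ↔ v = (u.1 + 1, u.2) ∨ v = (u.1 - 1, u.2) ∨ v = (u.1, u.2 + 1) ∨
      v = (u.1, u.2 - 1) := by
  obtain ⟨a, b⟩ := u
  obtain ⟨c, d⟩ := v
  simp only [grid, Prod.mk.injEq]
  constructor
  · intro h
    have h1 : -1 ≤ a - c := by nlinarith [sq_nonneg (b - d)]
    have h2 : a - c ≤ 1 := by nlinarith [sq_nonneg (b - d)]
    have h3 : -1 ≤ b - d := by nlinarith [sq_nonneg (a - c)]
    have h4 : b - d ≤ 1 := by nlinarith [sq_nonneg (a - c)]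
    generalize hx : a - c = x at *
    generalize hy : b - d = y at *
    interval_cases x <;> interval_cases y <;> simp at h <;> omega
  · rintro (⟨rfl, rfl⟩ | ⟨rfl, rfl⟩ | ⟨rfl, rfl⟩ | ⟨rfl, rfl⟩) <;> ring

theorem mem_edgesTouching (Λ : Finset Vertex) (e : Sym2 Vertex) :
    e ∈ edgesTouching Λ ↔ e ∈ grid.edgeSet ∧ ∃ v ∈ Λ, v ∈ e := by
  simp only [edgesTouching, Finset.mem_biUnion, Finset.mem_insert, Finset.mem_singleton]
  constructor
  · rintro ⟨v, hv, h⟩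
    refine ⟨?_, v, hv, ?_⟩
    · rcases h with rfl | rfl | rfl | rfl <;> rw [SimpleGraph.mem_edgeSet, grid_adj_iff] <;> simp
    · rcases h with rfl | rfl | rfl | rfl <;> simp
  · rintro ⟨he, v, hv, hve⟩
    obtain ⟨w, rfl⟩ := hve
    rw [SimpleGraph.mem_edgeSet, grid_adj_iff] at he
    refine ⟨v, hv, ?_⟩
    rcases he with rfl | rfl | rfl | rfl <;> simp

/-- Configurations on the whole lattice.  A partial configuration on a set `T` of vertices is
represented by any configuration restricting to it; all notions below that concern
a partial configuration on `T` only look at the values on `T`. -/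
abbrev Config (q : ℕ) : Type := Vertex → Fin q

end GridSpin

open GridSpin

/-- A `q`-spin system on `ℤ²`: a field `b` and a symmetric interaction matrix `A`, both with
nonnegative entries. -/
structure SpinSystem (q : ℕ) where
  b : Fin q → ℝ
  A : Matrix (Fin q) (Fin q) ℝ
  b_nonneg : ∀ i, 0 ≤ b i
  A_nonneg : ∀ i j, 0 ≤ A i j
  A_symm : ∀ i j, A i j = A j i

namespace SpinSystem

variable {q : ℕ}

/-- Some spin `i`, of positive field weight, has interactions bounded below by a positive
constant with every spin. -/
def IsSoft (M : SpinSystem q) : Prop :=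
  ∃ α : ℝ, 0 < α ∧ ∃ i : Fin q, 0 < M.b i ∧ ∀ j : Fin q, α < M.A i j

/-- The interaction along an edge. -/
def edgeWeight (M : SpinSystem q) (σ : Config q) : Sym2 Vertex → ℝ :=
  Sym2.lift ⟨fun u v => M.A (σ u) (σ v), fun _ _ => M.A_symm _ _⟩

/-- The weight of a configuration in the finite region `Λ`, including the interactions
between `Λ` and its boundary. -/
def weight (M : SpinSystem q) (Λ : Finset Vertex) (σ : Config q) : ℝ :=
  (∏ v ∈ Λ, M.b (σ v)) * ∏ e ∈ edgesTouching Λ, M.edgeWeight σ e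

/-- The configuration equal to `ξ` on `Λ` and to `η` off `Λ`. -/
def glue (Λ : Finset Vertex) (ξ : Λ → Fin q) (η : Config q) : Config q :=
  fun v => if h : v ∈ Λ then ξ ⟨v, h⟩ else η v

/-- The partition function of the finite region `Λ` with boundary condition `η` off `Λ`. -/
def partition (M : SpinSystem q) (Λ : Finset Vertex) (η : Config q) : ℝ :=
  ∑ ξ : Λ → Fin q, M.weight Λ (glue Λ ξ η)

/-- The marginal on the finite set `U` of the Gibbs distribution in the finite region `Λ`
with boundary condition `η` off `Λ`: the probability that the spins on `U` are given by `ρ`.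
The set `U` may contain vertices outside `Λ`; their spins are those of `η`. -/
def marginal (M : SpinSystem q) (Λ : Finset Vertex) (η : Config q) (U : Finset Vertex)
    (ρ : U → Fin q) : ℝ :=
  (∑ ξ : Λ → Fin q with ∀ u : U, glue Λ ξ η u = ρ u, M.weight Λ (glue Λ ξ η)) /
    M.partition Λ η

/-- The partial configuration given by `τ` on `T` is feasible: it extends to a configuration
in which all field weights and all interactions are positive. -/
def Feasible (M : SpinSystem q) (T : Set Vertex) (τ : Config q) : Prop :=
  ∃ σ : Config q, Set.EqOn σ τ T ∧ (∀ v, 0 < M.b (σ v)) ∧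
    ∀ u v, grid.Adj u v → 0 < M.A (σ u) (σ v)

/-- Total variation distance of two mass functions on a finite type. -/
def tv {α : Type*} [Fintype α] (p p' : α → ℝ) : ℝ :=
  (1 / 2) * ∑ a, |p a - p' a|

/-- Set weak spatial mixing with rate `f`.  Here `Λ` is the finite complement of the set
`W` of fixed vertices, so that `W` is `Λᶜ`; the sum over the infinite set `W` is taken
in `[0, ∞]`. -/
def WeakSpatialMixing (M : SpinSystem q) (f : ℕ → ℝ) : Prop :=
  ∀ (Λ U : Finset Vertex), U ⊆ Λ → ∀ τ₁ τ₂ : Config q,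
    M.Feasible ((Λ : Set Vertex)ᶜ) τ₁ → M.Feasible ((Λ : Set Vertex)ᶜ) τ₂ →
    ¬ Set.EqOn τ₁ τ₂ ((Λ : Set Vertex)ᶜ) →
    ENNReal.ofReal (tv (M.marginal Λ τ₁ U) (M.marginal Λ τ₂ U)) ≤
      ∑ u ∈ U, ∑' w : ((Λ : Set Vertex)ᶜ : Set Vertex), ENNReal.ofReal (f (grid.dist u w))

end SpinSystem

namespace GridSpin

/-- The open square of side `n` with lower left corner `c`: the points `c + (a, b)`
with `0 < a, b < n`. -/
def square (c : Vertex) (n : ℕ) : Finset Vertex :=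
  Finset.Ioo c.1 (c.1 + n) ×ˢ Finset.Ioo c.2 (c.2 + n)

/-- The bisected boundary of the square of side `2 * L` with lower left corner `c`:
the boundaries of the square and of its four quarters, and the centre of the square.
These are the boundary of the square and all its points on the two bisecting lines. -/
def bisectedBoundary (c : Vertex) (L : ℕ) : Set Vertex :=
  boundary (square c (2 * L)) ∪
    (boundary (square c L) ∪ boundary (square (c.1 + L, c.2) L) ∪
      boundary (square (c.1, c.2 + L) L) ∪ boundary (square (c.1 + L, c.2 + L) L)) ∪
    {(c.1 + (L : ℤ), c.2 + (L : ℤ))}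

/-- The points of the square of side `2 * L` at Euclidean distance at least `√L` from `y`. -/
def farPart (c : Vertex) (L : ℕ) (y : Vertex) : Finset Vertex :=
  (square c (2 * L)).filter fun x => (L : ℝ) ^ (1 / 2 : ℝ) ≤ euclDist x y

end GridSpin

end

open GridSpin

/-! Surround `y` by `g = ⌊L^{1/4}⌋` concentric `ℓ¹` annuli of width `g`; the last sphere has radius
`g ^ 2 ≤ √L`, so `Q` lies on or beyond it. The influence of `y` must cross every annulus, and each
crossing shrinks it by a constant factor `1 - δ`.

For one crossing, consider the part of a sphere in the free region outside the preceding one. Weak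
mixing charges an arc vertex for all fixed vertices near it, even those on which the two boundary
conditions agree. The fixed spins of the inner ball are at distance at least `g`, which beats the
polynomial number of arc vertices. The other fixed vertices lie on or behind six lines, the sides
and bisectors of the square. A sphere meets each parallel to such a line at most twice, so the
charges decay geometrically with the offset, and only boundedly many vertices near the lines have to
be excluded to make the total at most `1 / 2` (`exists_sum_tsum_exp_le`).

The excluded vertices are handled by softness: whatever the boundary condition, they all take the
soft spin with probability at least some constant `ε` (`exists_le_expect_of_soft`). Together these
give the contraction `exists_arc_contraction`. The tower property `expect_expect` iterates it in
`exists_influence_le`: an expectation beyond a sphere is an observable of the spins on the arc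
alone. -/

noncomputable section

open GridSpin

/-! ### Gluing, weights and positive configurations -/

namespace SpinSystem

variable {q : ℕ}

/-- A configuration of the whole lattice with positive weights throughout. -/
def IsPositive (M : SpinSystem q) (σ : Config q) : Prop :=
  (∀ v, 0 < M.b (σ v)) ∧ ∀ u v, grid.Adj u v → 0 < M.A (σ u) (σ v)

theorem glue_of_mem {Λ : Finset Vertex} (ξ : Λ → Fin q) (η : Config q) {v : Vertex} (h : v ∈ Λ) :
    glue Λ ξ η v = ξ ⟨v, h⟩ := by
  simp [glue, h]

theorem glue_of_notMem {Λ : Finset Vertex} (ξ : Λ → Fin q) (η : Config q) {v : Vertex}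
    (h : v ∉ Λ) : glue Λ ξ η v = η v := by
  simp [glue, h]

/-- The restriction of a configuration to a finite region. -/
def restrictTo (Λ : Finset Vertex) (σ : Config q) : Λ → Fin q := fun v => σ v

theorem restrictTo_glue (Λ : Finset Vertex) (ξ : Λ → Fin q) (η : Config q) :
    restrictTo Λ (glue Λ ξ η) = ξ := by
  funext v
  simp [restrictTo, glue]

theorem glue_restrictTo (Λ : Finset Vertex) {σ η : Config q} (h : ∀ v, v ∉ Λ → σ v = η v) :
    glue Λ (restrictTo Λ σ) η = σ := by
  funext v
  by_cases hv : v ∈ Λ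
  · simp [glue_of_mem _ _ hv, restrictTo]
  · rw [glue_of_notMem _ _ hv, h v hv]

theorem edgeWeight_nonneg (M : SpinSystem q) (σ : Config q) (e : Sym2 Vertex) :
    0 ≤ M.edgeWeight σ e := by
  induction e with
  | _ u v => exact M.A_nonneg _ _

theorem edgeWeight_congr (M : SpinSystem q) {σ σ' : Config q} {e : Sym2 Vertex}
    (h : ∀ v ∈ e, σ v = σ' v) : M.edgeWeight σ e = M.edgeWeight σ' e := by
  induction e with
  | _ u v =>
    change M.A _ _ = M.A _ _
    rw [h u (by simp), h v (by simp)]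

theorem weight_nonneg (M : SpinSystem q) (Λ : Finset Vertex) (σ : Config q) :
    0 ≤ M.weight Λ σ :=
  mul_nonneg (Finset.prod_nonneg fun _ _ => M.b_nonneg _)
    (Finset.prod_nonneg fun _ _ => M.edgeWeight_nonneg _ _)

theorem weight_congr (M : SpinSystem q) {Λ : Finset Vertex} {σ σ' : Config q}
    (h : ∀ v ∈ Λ, σ v = σ' v) (h' : ∀ v ∈ boundary Λ, σ v = σ' v) :
    M.weight Λ σ = M.weight Λ σ' := by
  unfold weight
  congr 1
  · exact Finset.prod_congr rfl fun v hv => by rw [h v hv]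
  · refine Finset.prod_congr rfl fun e he => M.edgeWeight_congr fun u hu => ?_
    obtain ⟨hadj, v, hv, hve⟩ := (mem_edgesTouching Λ e).1 he
    by_cases huΛ : u ∈ Λ
    · exact h u huΛ
    · refine h' u ⟨huΛ, v, hv, ?_⟩
      have hne : v ≠ u := by rintro rfl; exact huΛ hv
      have he' : e = s(v, u) := (Sym2.mem_and_mem_iff hne).1 ⟨hve, hu⟩
      rwa [he', SimpleGraph.mem_edgeSet] at hadj

/-- The factor of the weight in `Λ` that does not involve the subregion `Λ'`. -/
def outerWeight (M : SpinSystem q) (Λ Λ' : Finset Vertex) (σ : Config q) : ℝ :=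
  (∏ v ∈ Λ \ Λ', M.b (σ v)) * ∏ e ∈ edgesTouching Λ \ edgesTouching Λ', M.edgeWeight σ e

theorem edgesTouching_mono {Λ Λ' : Finset Vertex} (h : Λ' ⊆ Λ) :
    edgesTouching Λ' ⊆ edgesTouching Λ :=
  Finset.biUnion_subset_biUnion_of_subset_left _ h

theorem weight_eq_outerWeight_mul (M : SpinSystem q) {Λ Λ' : Finset Vertex} (h : Λ' ⊆ Λ)
    (σ : Config q) : M.weight Λ σ = M.outerWeight Λ Λ' σ * M.weight Λ' σ := by
  unfold weight outerWeight
  rw [← Finset.prod_sdiff h, ← Finset.prod_sdiff (edgesTouching_mono h)]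
  ring

theorem outerWeight_congr (M : SpinSystem q) {Λ Λ' : Finset Vertex} {σ σ' : Config q}
    (h : ∀ v, v ∉ Λ' → σ v = σ' v) : M.outerWeight Λ Λ' σ = M.outerWeight Λ Λ' σ' := by
  unfold outerWeight
  congr 1
  · exact Finset.prod_congr rfl fun v hv => by rw [h v (Finset.mem_sdiff.1 hv).2]
  · refine Finset.prod_congr rfl fun e he => M.edgeWeight_congr fun u hu => h u fun huΛ => ?_
    obtain ⟨h1, h2⟩ := Finset.mem_sdiff.1 he
    exact h2 ((mem_edgesTouching _ _).2 ⟨((mem_edgesTouching _ _).1 h1).1, u, huΛ, hu⟩)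

theorem IsPositive.weight_pos {M : SpinSystem q} {σ : Config q} (h : M.IsPositive σ)
    (Λ : Finset Vertex) : 0 < M.weight Λ σ := by
  refine mul_pos (Finset.prod_pos fun _ _ => h.1 _) (Finset.prod_pos fun e he => ?_)
  have he' := ((mem_edgesTouching _ _).1 he).1
  induction e with
  | _ u v => exact h.2 u v he'

/-- Factors touching `Λ` occur in the weight, and the others see only `η`. So a Gibbs distribution
with positive boundary condition charges only positive configurations, and observables need be
compared only on these. -/
theorem IsPositive.of_weight_ne_zero {M : SpinSystem q} {η σ : Config q} (h : M.IsPositive η)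
    {Λ : Finset Vertex} (hσ : ∀ v, v ∉ Λ → σ v = η v) (hw : M.weight Λ σ ≠ 0) :
    M.IsPositive σ := by
  obtain ⟨hb, he⟩ := mul_ne_zero_iff.1 hw
  rw [Finset.prod_ne_zero_iff] at hb he
  refine ⟨fun v => ?_, fun u v huv => ?_⟩
  · by_cases hv : v ∈ Λ
    · exact (M.b_nonneg _).lt_of_ne' (hb v hv)
    · rw [hσ v hv]; exact h.1 v
  · by_cases hu : u ∈ Λ ∨ v ∈ Λ
    · refine (M.A_nonneg _ _).lt_of_ne' (he s(u, v) ((mem_edgesTouching _ _).2 ⟨huv, ?_⟩))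
      rcases hu with hu | hu
      · exact ⟨u, hu, by simp⟩
      · exact ⟨v, hu, by simp⟩
    · push Not at hu
      rw [hσ u hu.1, hσ v hu.2]
      exact h.2 u v huv

theorem IsPositive.partition_pos {M : SpinSystem q} {η : Config q} (h : M.IsPositive η)
    (Λ : Finset Vertex) : 0 < M.partition Λ η := by
  refine Finset.sum_pos' (fun _ _ => M.weight_nonneg _ _) ⟨restrictTo Λ η, Finset.mem_univ _, ?_⟩
  rw [glue_restrictTo Λ fun _ _ => rfl]
  exact h.weight_pos Λ

/-! ### Gibbs expectations and the tower property -/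

/-- The expectation of an observable under the Gibbs distribution in `Λ` with boundary
condition `η`. -/
def expect (M : SpinSystem q) (Λ : Finset Vertex) (η : Config q) (f : Config q → ℝ) : ℝ :=
  (∑ ξ : Λ → Fin q, M.weight Λ (glue Λ ξ η) * f (glue Λ ξ η)) / M.partition Λ η

section Expect

variable {M : SpinSystem q} {Λ : Finset Vertex} {η η' : Config q} {f g : Config q → ℝ}

theorem expect_congr (hη : M.IsPositive η)
    (h : ∀ σ, M.IsPositive σ → (∀ v, v ∉ Λ → σ v = η v) → f σ = g σ) :
    M.expect Λ η f = M.expect Λ η g := by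
  unfold expect
  congr 1
  refine Finset.sum_congr rfl fun ξ _ => ?_
  by_cases hw : M.weight Λ (glue Λ ξ η) = 0
  · simp [hw]
  · have hoff : ∀ v, v ∉ Λ → glue Λ ξ η v = η v := fun v hv => glue_of_notMem _ _ hv
    rw [h _ (hη.of_weight_ne_zero hoff hw) hoff]

theorem expect_mono (hη : M.IsPositive η)
    (h : ∀ σ, M.IsPositive σ → (∀ v, v ∉ Λ → σ v = η v) → f σ ≤ g σ) :
    M.expect Λ η f ≤ M.expect Λ η g := by
  unfold expect
  refine div_le_div_of_nonneg_right (Finset.sum_le_sum fun ξ _ => ?_) (hη.partition_pos Λ).le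
  by_cases hw : M.weight Λ (glue Λ ξ η) = 0
  · simp [hw]
  · have hoff : ∀ v, v ∉ Λ → glue Λ ξ η v = η v := fun v hv => glue_of_notMem _ _ hv
    exact mul_le_mul_of_nonneg_left (h _ (hη.of_weight_ne_zero hoff hw) hoff)
      (M.weight_nonneg _ _)

theorem expect_const (hη : M.IsPositive η) (a : ℝ) : M.expect Λ η (fun _ => a) = a := by
  unfold expect
  rw [← Finset.sum_mul]
  exact mul_div_cancel_left₀ a (hη.partition_pos Λ).ne'

theorem expect_sub : M.expect Λ η (fun σ => f σ - g σ) = M.expect Λ η f - M.expect Λ η g := by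
  simp only [expect, mul_sub, Finset.sum_sub_distrib, sub_div]

theorem expect_const_mul (a : ℝ) :
    M.expect Λ η (fun σ => a * f σ) = a * M.expect Λ η f := by
  simp only [expect, mul_div_assoc', Finset.mul_sum]
  congr 1
  exact Finset.sum_congr rfl fun _ _ => by ring

theorem expect_sum {ι : Type*} (s : Finset ι) (F : ι → Config q → ℝ) :
    M.expect Λ η (fun σ => ∑ i ∈ s, F i σ) = ∑ i ∈ s, M.expect Λ η (F i) := by
  simp only [expect, Finset.mul_sum, ← Finset.sum_div]
  rw [Finset.sum_comm]

theorem partition_congr (h : ∀ v ∈ boundary Λ, η v = η' v) :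
    M.partition Λ η = M.partition Λ η' := by
  refine Finset.sum_congr rfl fun ξ _ => M.weight_congr (fun v hv => ?_) fun v hv => ?_
  · rw [glue_of_mem _ _ hv, glue_of_mem _ _ hv]
  · rw [glue_of_notMem _ _ hv.1, glue_of_notMem _ _ hv.1, h v hv]

/-- The Gibbs distribution in `Λ` depends only on the boundary condition on `∂Λ`. -/
theorem expect_congr_boundary (h : ∀ v ∈ boundary Λ, η v = η' v)
    (hf : ∀ ξ, f (glue Λ ξ η) = f (glue Λ ξ η')) :
    M.expect Λ η f = M.expect Λ η' f := by
  unfold expect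
  rw [partition_congr h]
  congr 1
  refine Finset.sum_congr rfl fun ξ _ => ?_
  rw [hf, M.weight_congr (σ' := glue Λ ξ η') (fun v hv => ?_) fun v hv => ?_]
  · rw [glue_of_mem _ _ hv, glue_of_mem _ _ hv]
  · rw [glue_of_notMem _ _ hv.1, glue_of_notMem _ _ hv.1, h v hv]

theorem glue_congr {ξ : Λ → Fin q} (h : ∀ v, v ∉ Λ → η v = η' v) :
    glue Λ ξ η = glue Λ ξ η' := by
  funext v
  by_cases hv : v ∈ Λ
  · rw [glue_of_mem _ _ hv, glue_of_mem _ _ hv]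
  · rw [glue_of_notMem _ _ hv, glue_of_notMem _ _ hv, h v hv]

/-- Exchange the spins in `Λ'` between a configuration on `Λ ⊇ Λ'` and one on `Λ'`. -/
def swapEquiv {Λ Λ' : Finset Vertex} (h : Λ' ⊆ Λ) (η : Config q) :
    (Λ → Fin q) × (Λ' → Fin q) ≃ (Λ → Fin q) × (Λ' → Fin q) :=
  Function.Involutive.toPerm
    (fun p => (restrictTo Λ (glue Λ' p.2 (glue Λ p.1 η)), restrictTo Λ' (glue Λ p.1 η))) (by
    rintro ⟨ξ, ζ⟩
    have hoff : ∀ v, v ∉ Λ → glue Λ' ζ (glue Λ ξ η) v = η v := fun v hv => by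
      rw [glue_of_notMem _ _ fun h' => hv (h h'), glue_of_notMem _ _ hv]
    simp only [glue_restrictTo Λ hoff]
    rw [restrictTo_glue, glue_restrictTo Λ', restrictTo_glue]
    intro v hv
    rw [glue_of_notMem _ _ hv])

/-- The tower property of Gibbs distributions. -/
theorem expect_expect (hη : M.IsPositive η) {Λ' : Finset Vertex} (h : Λ' ⊆ Λ)
    (f : Config q → ℝ) :
    M.expect Λ η (fun σ => M.expect Λ' σ f) = M.expect Λ η f := by
  -- Resampling in `Λ'` is reversible. Both double sums carry the joint weight of a configuration
  -- and its resampling; `W` evaluates `f` after it, `W'` before it.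
  let W : (Λ → Fin q) × (Λ' → Fin q) → ℝ := fun p =>
    M.weight Λ (glue Λ p.1 η) * (M.weight Λ' (glue Λ' p.2 (glue Λ p.1 η)) *
      f (glue Λ' p.2 (glue Λ p.1 η)) / M.partition Λ' (glue Λ p.1 η))
  let W' : (Λ → Fin q) × (Λ' → Fin q) → ℝ := fun p =>
    M.weight Λ (glue Λ p.1 η) * f (glue Λ p.1 η) *
      (M.weight Λ' (glue Λ' p.2 (glue Λ p.1 η)) / M.partition Λ' (glue Λ p.1 η))
  have hW : ∑ p, W p = ∑ p, W' p := by
    rw [← Equiv.sum_comp (swapEquiv h η) W']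
    refine Finset.sum_congr rfl ?_
    rintro ⟨ξ, ζ⟩ -
    have hoff : ∀ v, v ∉ Λ → glue Λ' ζ (glue Λ ξ η) v = η v := fun v hv => by
      rw [glue_of_notMem _ _ fun h' => hv (h h'), glue_of_notMem _ _ hv]
    have hoff' : ∀ v, v ∉ Λ' → glue Λ' ζ (glue Λ ξ η) v = glue Λ ξ η v := fun v hv =>
      glue_of_notMem _ _ hv
    have e1 : glue Λ (swapEquiv h η (ξ, ζ)).1 η = glue Λ' ζ (glue Λ ξ η) :=
      glue_restrictTo Λ hoff
    have e2 : glue Λ' (swapEquiv h η (ξ, ζ)).2 (glue Λ' ζ (glue Λ ξ η)) = glue Λ ξ η :=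
      glue_restrictTo Λ' fun v hv => (hoff' v hv).symm
    simp only [W, W', e1, e2]
    -- The outer weight and the partition function of `Λ'` see only spins off `Λ'`, which the swap
    -- leaves alone.
    rw [M.weight_eq_outerWeight_mul h, M.weight_eq_outerWeight_mul h (glue Λ' ζ (glue Λ ξ η)),
      M.outerWeight_congr hoff', partition_congr fun v hv => hoff' v hv.1]
    ring
  unfold expect
  congr 1
  have l : ∑ p, W p = ∑ ξ : Λ → Fin q, M.weight Λ (glue Λ ξ η) *
      ((∑ ζ : Λ' → Fin q, M.weight Λ' (glue Λ' ζ (glue Λ ξ η)) * f (glue Λ' ζ (glue Λ ξ η))) /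
        M.partition Λ' (glue Λ ξ η)) := by
    rw [Fintype.sum_prod_type]
    simp only [W, ← Finset.mul_sum, ← Finset.sum_div]
  have r : ∑ p, W' p = ∑ ξ : Λ → Fin q, M.weight Λ (glue Λ ξ η) * f (glue Λ ξ η) := by
    rw [Fintype.sum_prod_type]
    refine Finset.sum_congr rfl fun ξ _ => ?_
    simp only [W', ← Finset.mul_sum, ← Finset.sum_div]
    by_cases hw : M.weight Λ (glue Λ ξ η) = 0
    · simp [hw]
    · have hp := hη.of_weight_ne_zero (fun v hv => glue_of_notMem ξ η hv) hw
      change _ * (M.partition Λ' (glue Λ ξ η) / _) = _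
      rw [div_self (hp.partition_pos Λ').ne', mul_one]
  rw [← l, hW, r]

theorem marginal_eq_expect (U : Finset Vertex) (ρ : U → Fin q) :
    M.marginal Λ η U ρ = M.expect Λ η fun σ => if restrictTo U σ = ρ then 1 else 0 := by
  unfold marginal expect
  congr 1
  rw [Finset.sum_filter]
  refine Finset.sum_congr rfl fun ξ _ => ?_
  simp only [funext_iff, restrictTo, mul_ite, mul_one, mul_zero]

theorem expect_comp_restrictTo (U : Finset Vertex) (F : (U → Fin q) → ℝ) :
    M.expect Λ η (fun σ => F (restrictTo U σ)) = ∑ ρ, F ρ * M.marginal Λ η U ρ := by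
  simp only [marginal_eq_expect, ← expect_const_mul, ← expect_sum]
  congr 1
  funext σ
  simp

theorem sum_marginal (hη : M.IsPositive η) (U : Finset Vertex) :
    ∑ ρ, M.marginal Λ η U ρ = 1 := by
  have h := expect_comp_restrictTo (M := M) (Λ := Λ) (η := η) U fun _ => 1
  rw [expect_const hη] at h
  simpa using h.symm

end Expect

/-! ### Total variation distance and test functions -/

theorem sum_mul_sub_le_tv {α : Type*} [Fintype α] {p p' F : α → ℝ} (h : ∑ a, p a = ∑ a, p' a)
    {m s : ℝ} (hm : ∀ a, m ≤ F a) (hs : ∀ a, F a ≤ m + s) :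
    ∑ a, F a * p a - ∑ a, F a * p' a ≤ s * tv p p' := by
  -- Equal masses allow centring `F` at the midpoint of its range, so that its absolute value is at
  -- most `s / 2`.
  have e : ∑ a, F a * p a - ∑ a, F a * p' a = ∑ a, (F a - m - s / 2) * (p a - p' a) := by
    have : ∑ a, (m + s / 2) * (p a - p' a) = 0 := by
      rw [← Finset.mul_sum, Finset.sum_sub_distrib, h, sub_self, mul_zero]
    rw [← Finset.sum_sub_distrib, ← sub_zero (∑ a, (F a * p a - F a * p' a)), ← this,
      ← Finset.sum_sub_distrib]
    exact Finset.sum_congr rfl fun _ _ => by ring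
  rw [e, tv, Finset.mul_sum, Finset.mul_sum]
  refine Finset.sum_le_sum fun a _ => (le_abs_self _).trans ?_
  rw [abs_mul, ← mul_assoc]
  refine mul_le_mul_of_nonneg_right (abs_le.2 ⟨?_, ?_⟩) (abs_nonneg _)
  · linarith [hm a]
  · linarith [hs a]

/-- The indicator of `{p' ≤ p}` attains the distance, because the positive and negative parts of `p
- p'` have equal mass. -/
theorem tv_le_of_forall {α : Type*} [Fintype α] {p p' : α → ℝ} (h : ∑ a, p a = ∑ a, p' a) {ε : ℝ}
    (H : ∀ F : α → ℝ, (∀ a, 0 ≤ F a) → (∀ a, F a ≤ 1) →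
      ∑ a, F a * p a - ∑ a, F a * p' a ≤ ε) : tv p p' ≤ ε := by
  classical
  refine le_trans (le_of_eq ?_) (H (fun a => if p' a ≤ p a then 1 else 0)
    (fun a => by split_ifs <;> norm_num) fun a => by split_ifs <;> norm_num)
  have e : ∑ a, |p a - p' a| = 2 * (∑ a, (if p' a ≤ p a then 1 else 0) * p a -
      ∑ a, (if p' a ≤ p a then 1 else 0) * p' a) - (∑ a, p a - ∑ a, p' a) := by
    rw [← Finset.sum_sub_distrib, ← Finset.sum_sub_distrib, Finset.mul_sum,
      ← Finset.sum_sub_distrib]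
    refine Finset.sum_congr rfl fun a _ => ?_
    split_ifs with ha
    · rw [abs_of_nonneg (by linarith)]; ring
    · rw [abs_of_nonpos (by linarith)]; ring
  rw [tv, e, h]
  ring

/-! ### Softness -/

/-- Set all the spins in `V` to `i`. -/
def setSpins (V : Finset Vertex) (i : Fin q) (σ : Config q) : Config q :=
  glue V (fun _ => i) σ

theorem IsPositive.setSpins {M : SpinSystem q} {i : Fin q} (hb : 0 < M.b i)
    (hA : ∀ j, 0 < M.A i j) {σ : Config q} (hσ : M.IsPositive σ) (V : Finset Vertex) :
    M.IsPositive (setSpins V i σ) := by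
  have key : ∀ v, SpinSystem.setSpins V i σ v = i ∨ SpinSystem.setSpins V i σ v = σ v := by
    intro v
    by_cases hv : v ∈ V
    · exact Or.inl (glue_of_mem _ _ hv)
    · exact Or.inr (glue_of_notMem _ _ hv)
  refine ⟨fun v => ?_, fun u v huv => ?_⟩
  · rcases key v with h | h <;> rw [h]
    exacts [hb, hσ.1 v]
  · rcases key u with h | h
    · rw [h]; exact hA _
    · rcases key v with h' | h'
      · rw [h', M.A_symm]; exact hA _
      · rw [h, h']; exact hσ.2 u v huv

theorem card_edgesTouching_le (V : Finset Vertex) : (edgesTouching V).card ≤ 4 * V.card := by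
  rw [mul_comm]
  exact Finset.card_biUnion_le_card_mul _ _ _ fun _ _ => Finset.card_le_four

/-- In a soft system, whatever happens outside a set of at most `k` vertices, all its spins take
the soft value with a probability bounded below. -/
theorem exists_le_expect_of_soft (M : SpinSystem q) {i : Fin q} {α : ℝ} (hα : 0 < α)
    (hb : 0 < M.b i) (hA : ∀ j, α < M.A i j) (k : ℕ) :
    ∃ ε : ℝ, 0 < ε ∧ ε ≤ 1 ∧ ∀ (Λ V : Finset Vertex) (η : Config q) (h : Config q → ℝ),
      M.IsPositive η → V ⊆ Λ → V.card ≤ k →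
      (∀ σ, M.IsPositive σ → (∀ v, v ∉ Λ → σ v = η v) → 0 ≤ h σ) →
      ε * M.expect Λ η (fun σ => h (setSpins V i σ)) ≤ M.expect Λ η h := by
  obtain ⟨B, hB1, hB⟩ : ∃ B : ℝ, 1 ≤ B ∧ ∀ j, M.b j ≤ B := by
    have h0 : 0 ≤ ∑ j, M.b j := Finset.sum_nonneg fun j _ => M.b_nonneg j
    refine ⟨1 + ∑ j, M.b j, by linarith, fun j => ?_⟩
    have h1 := Finset.single_le_sum (fun j _ => M.b_nonneg j) (Finset.mem_univ j)
    linarith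
  obtain ⟨K, hK1, hK⟩ : ∃ K : ℝ, 1 ≤ K ∧ ∀ j l, M.A j l ≤ K := by
    have h0 : 0 ≤ ∑ p : Fin q × Fin q, M.A p.1 p.2 :=
      Finset.sum_nonneg fun p _ => M.A_nonneg p.1 p.2
    refine ⟨1 + ∑ p : Fin q × Fin q, M.A p.1 p.2, by linarith, fun j l => ?_⟩
    have h1 := Finset.single_le_sum (f := fun p : Fin q × Fin q => M.A p.1 p.2)
      (fun p _ => M.A_nonneg p.1 p.2) (Finset.mem_univ (j, l))
    change M.A j l ≤ _ at h1
    linarith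
  have hq : (1 : ℝ) ≤ q := by
    have := i.pos
    exact_mod_cast this
  set β := min (min α (M.b i)) 1 with hβ
  have hβ0 : 0 < β := lt_min (lt_min hα hb) one_pos
  have hβ1 : β ≤ 1 := min_le_right _ _
  have hβα : β ≤ α := (min_le_left _ _).trans (min_le_left _ _)
  have hβb : β ≤ M.b i := (min_le_left _ _).trans (min_le_right _ _)
  have hD : 0 < (q : ℝ) ^ k * (B ^ k * K ^ (4 * k)) := by positivity
  have hD1 : 1 ≤ (q : ℝ) ^ k * (B ^ k * K ^ (4 * k)) :=
    one_le_mul_of_one_le_of_one_le (one_le_pow₀ hq)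
      (one_le_mul_of_one_le_of_one_le (one_le_pow₀ hB1) (one_le_pow₀ hK1))
  -- Least weight of the constant spin `i` on at most `k` vertices and `4 * k` edges, over the
  -- number of configurations times the largest weight. As `β ≤ 1 ≤ B, K`, the exponents also serve
  -- smaller sets.
  refine ⟨β ^ k * β ^ (4 * k) / (q ^ k * (B ^ k * K ^ (4 * k))), by positivity, ?_, ?_⟩
  · rw [div_le_one hD]
    exact le_trans (mul_le_one₀ (pow_le_one₀ hβ0.le hβ1) (by positivity)
      (pow_le_one₀ hβ0.le hβ1)) hD1
  intro Λ V η h hη hVΛ hVk hh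
  rw [← expect_const_mul, ← expect_expect hη hVΛ h]
  refine expect_mono hη fun σ hσ hση => ?_
  have hpos : M.IsPositive (setSpins V i σ) := hσ.setSpins hb (fun j => hα.trans (hA j)) V
  have hoff : ∀ ξ : V → Fin q, ∀ v, v ∉ Λ → glue V ξ σ v = η v := fun ξ v hv => by
    rw [glue_of_notMem _ _ fun h' => hv (hVΛ h'), hση v hv]
  have hh0 : 0 ≤ h (setSpins V i σ) := hh _ hpos (hoff _)
  have hE : (edgesTouching V).card ≤ 4 * k :=
    (card_edgesTouching_le V).trans (Nat.mul_le_mul_left 4 hVk)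
  have hw : β ^ k * β ^ (4 * k) ≤ M.weight V (setSpins V i σ) := by
    refine mul_le_mul ?_ ?_ (by positivity) (Finset.prod_nonneg fun _ _ => M.b_nonneg _)
    · refine (pow_le_pow_of_le_one hβ0.le hβ1 hVk).trans ?_
      rw [← Finset.prod_const]
      refine Finset.prod_le_prod (fun _ _ => hβ0.le) fun v hv => ?_
      rw [setSpins, glue_of_mem _ _ hv]
      exact hβb
    · refine (pow_le_pow_of_le_one hβ0.le hβ1 hE).trans ?_
      rw [← Finset.prod_const]
      refine Finset.prod_le_prod (fun _ _ => hβ0.le) fun e he => hβα.trans ?_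
      obtain ⟨-, v, hv, hve⟩ := (mem_edgesTouching _ _).1 he
      obtain ⟨u, rfl⟩ := hve
      change α ≤ M.A _ _
      rw [setSpins, glue_of_mem _ _ hv]
      exact (hA _).le
  have hZ : M.partition V σ ≤ q ^ k * (B ^ k * K ^ (4 * k)) := by
    refine (Finset.sum_le_card_nsmul _ _ (B ^ k * K ^ (4 * k)) fun ξ _ => ?_).trans ?_
    · refine mul_le_mul ?_ ?_ (Finset.prod_nonneg fun _ _ => M.edgeWeight_nonneg _ _)
        (by positivity)
      · refine le_trans ?_ (pow_le_pow_right₀ hB1 hVk)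
        rw [← Finset.prod_const]
        exact Finset.prod_le_prod (fun _ _ => M.b_nonneg _) fun _ _ => hB _
      · refine le_trans ?_ (pow_le_pow_right₀ hK1 hE)
        rw [← Finset.prod_const]
        refine Finset.prod_le_prod (fun _ _ => M.edgeWeight_nonneg _ _) fun e _ => ?_
        induction e with
        | _ u v => exact hK _ _
    · rw [nsmul_eq_mul]
      refine mul_le_mul_of_nonneg_right ?_ (by positivity)
      simp only [Finset.card_univ, Fintype.card_pi, Fintype.card_fin, Finset.prod_const,
        Fintype.card_coe]
      push_cast
      exact pow_le_pow_right₀ hq hVk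
  unfold expect
  refine (mul_le_mul_of_nonneg_right (div_le_div₀ (M.weight_nonneg _ _) hw
    (hσ.partition_pos V) hZ) hh0).trans ?_
  rw [div_mul_eq_mul_div]
  refine div_le_div_of_nonneg_right ?_ (hσ.partition_pos V).le
  -- With the spins off `V` frozen, keep only the term of the constant spin `i`.
  refine Finset.single_le_sum (f := fun ξ : V → Fin q => M.weight V (glue V ξ σ) * h (glue V ξ σ))
    (fun ξ _ => ?_) (Finset.mem_univ fun _ => i)
  by_cases hwξ : M.weight V (glue V ξ σ) = 0
  · simp [hwξ]
  · exact mul_nonneg (M.weight_nonneg _ _)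
      (hh _ (hσ.of_weight_ne_zero (fun v hv => glue_of_notMem _ _ hv) hwξ) (hoff ξ))

end SpinSystem

/-! ### Lattice distance and spheres -/

namespace GridSpin

/-- The `ℓ¹` distance on the lattice. -/
def latticeDist (u w : Vertex) : ℕ := (u.1 - w.1).natAbs + (u.2 - w.2).natAbs

theorem latticeDist_le_add_one_of_adj {u v : Vertex} (w : Vertex) (h : grid.Adj u v) :
    latticeDist w v ≤ latticeDist w u + 1 := by
  rcases (grid_adj_iff u v).1 h with rfl | rfl | rfl | rfl <;> simp only [latticeDist] <;> omega

theorem latticeDist_le_length {u v : Vertex} (p : grid.Walk u v) :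
    latticeDist u v ≤ p.length := by
  induction p with
  | nil => simp [latticeDist]
  | @cons a b c h p ih =>
    have h1 := latticeDist_le_add_one_of_adj c h.symm
    simp only [latticeDist, SimpleGraph.Walk.length_cons] at *
    omega

theorem reachable_shift_right (a b : ℤ) (n : ℕ) : grid.Reachable (a, b) (a + n, b) := by
  induction n with
  | zero => simp
  | succ n ih =>
    refine ih.trans (SimpleGraph.Adj.reachable ?_)
    rw [grid_adj_iff]
    left
    push_cast
    rw [add_assoc]

theorem reachable_shift_up (a b : ℤ) (n : ℕ) : grid.Reachable (a, b) (a, b + n) := by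
  induction n with
  | zero => simp
  | succ n ih =>
    refine ih.trans (SimpleGraph.Adj.reachable ?_)
    rw [grid_adj_iff]
    right; right; left
    push_cast
    rw [add_assoc]

/-- Rules out the default value `0` of `dist` for unreachable vertices, which would break the lower
bound by `latticeDist`. -/
theorem grid_reachable (u w : Vertex) : grid.Reachable u w := by
  obtain ⟨a, b⟩ := u
  obtain ⟨c, d⟩ := w
  have h1 : grid.Reachable (a, b) (c, b) := by
    rcases le_total a c with h | h
    · obtain ⟨n, hn⟩ := Int.le.dest h
      rw [← hn]; exact reachable_shift_right a b n
    · obtain ⟨n, hn⟩ := Int.le.dest h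
      rw [← hn]; exact (reachable_shift_right c b n).symm
  have h2 : grid.Reachable (c, b) (c, d) := by
    rcases le_total b d with h | h
    · obtain ⟨n, hn⟩ := Int.le.dest h
      rw [← hn]; exact reachable_shift_up c b n
    · obtain ⟨n, hn⟩ := Int.le.dest h
      rw [← hn]; exact (reachable_shift_up c d n).symm
  exact h1.trans h2

theorem latticeDist_le_dist (u w : Vertex) : latticeDist u w ≤ grid.dist u w := by
  obtain ⟨p, hp⟩ := (grid_reachable u w).exists_walk_length_eq_dist
  exact hp ▸ latticeDist_le_length p

theorem euclDist_le_latticeDist (u w : Vertex) : euclDist u w ≤ latticeDist u w := by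
  refine Real.sqrt_le_iff.2 ⟨by positivity, ?_⟩
  have h1 : ((latticeDist u w : ℕ) : ℝ) = |(u.1 : ℝ) - w.1| + |(u.2 : ℝ) - w.2| := by
    simp [latticeDist, Nat.cast_natAbs]
  rw [h1, add_sq, sq_abs, sq_abs]
  have := mul_nonneg (abs_nonneg ((u.1 : ℝ) - w.1)) (abs_nonneg ((u.2 : ℝ) - w.2))
  linarith

section Sphere

variable {U : Finset Vertex} {y : Vertex} {R : ℕ}

/-- A sphere of the lattice meets every vertical line at most twice. -/
theorem card_filter_fst_le (hU : ∀ u ∈ U, latticeDist y u = R) (t : ℤ) :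
    (U.filter fun u => u.1 = t).card ≤ 2 := by
  refine (Finset.card_le_card (t := {(t, y.2 + (R - (y.1 - t).natAbs)),
    (t, y.2 - (R - (y.1 - t).natAbs))}) fun u hu => ?_).trans Finset.card_le_two
  obtain ⟨a, b⟩ := u
  obtain ⟨h1, rfl⟩ := Finset.mem_filter.1 hu
  have := hU _ h1
  simp only [latticeDist, Finset.mem_insert, Finset.mem_singleton, Prod.mk.injEq,
    true_and] at this ⊢
  omega

/-- A sphere of the lattice meets every horizontal line at most twice. -/
theorem card_filter_snd_le (hU : ∀ u ∈ U, latticeDist y u = R) (t : ℤ) :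
    (U.filter fun u => u.2 = t).card ≤ 2 := by
  refine (Finset.card_le_card (t := {(y.1 + (R - (y.2 - t).natAbs), t),
    (y.1 - (R - (y.2 - t).natAbs), t)}) fun u hu => ?_).trans Finset.card_le_two
  obtain ⟨a, b⟩ := u
  obtain ⟨h1, rfl⟩ := Finset.mem_filter.1 hu
  have := hU _ h1
  simp only [latticeDist, Finset.mem_insert, Finset.mem_singleton, Prod.mk.injEq,
    and_true] at this ⊢
  omega

theorem card_le_of_sphere (hU : ∀ u ∈ U, latticeDist y u = R) : U.card ≤ (2 * R + 1) ^ 2 := by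
  refine (Finset.card_le_card (t := Finset.Icc (y.1 - R) (y.1 + R) ×ˢ
    Finset.Icc (y.2 - R) (y.2 + R)) fun u hu => ?_).trans ?_
  · have := hU u hu
    simp only [latticeDist, Finset.mem_product, Finset.mem_Icc] at *
    omega
  · rw [Finset.card_product, Int.card_Icc, Int.card_Icc, sq]
    refine le_of_eq ?_
    congr 1 <;> omega

/-- The vertices of a sphere whose offset from one of the given vertical or horizontal lines
lies in `s`. -/
def nearLines (s A₁ A₂ : Finset ℤ) (U : Finset Vertex) : Finset Vertex :=
  U.filter fun u => (∃ a ∈ A₁, u.1 - a ∈ s) ∨ ∃ a ∈ A₂, u.2 - a ∈ s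

theorem card_nearLines_le (hU : ∀ u ∈ U, latticeDist y u = R) (s : Finset ℤ) {A₁ A₂ : Finset ℤ}
    (h₁ : A₁.card ≤ 3) (h₂ : A₂.card ≤ 3) : (nearLines s A₁ A₂ U).card ≤ 12 * s.card := by
  have hsub : nearLines s A₁ A₂ U ⊆
      (A₁.biUnion fun a => s.biUnion fun t => U.filter fun u => u.1 = a + t) ∪
      (A₂.biUnion fun a => s.biUnion fun t => U.filter fun u => u.2 = a + t) := by
    intro u hu
    obtain ⟨huU, ⟨a, ha, h⟩ | ⟨a, ha, h⟩⟩ := Finset.mem_filter.1 hu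
    · refine Finset.mem_union_left _ (Finset.mem_biUnion.2 ⟨a, ha, Finset.mem_biUnion.2
        ⟨_, h, Finset.mem_filter.2 ⟨huU, by ring⟩⟩⟩)
    · refine Finset.mem_union_right _ (Finset.mem_biUnion.2 ⟨a, ha, Finset.mem_biUnion.2
        ⟨_, h, Finset.mem_filter.2 ⟨huU, by ring⟩⟩⟩)
  refine (Finset.card_le_card hsub).trans ((Finset.card_union_le _ _).trans ?_)
  have e1 := Finset.card_biUnion_le_card_mul A₁
    (fun a => s.biUnion fun t => U.filter fun u => u.1 = a + t) (s.card * 2) fun a _ =>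
    Finset.card_biUnion_le_card_mul _ _ _ fun t _ => card_filter_fst_le hU _
  have e2 := Finset.card_biUnion_le_card_mul A₂
    (fun a => s.biUnion fun t => U.filter fun u => u.2 = a + t) (s.card * 2) fun a _ =>
    Finset.card_biUnion_le_card_mul _ _ _ fun t _ => card_filter_snd_le hU _
  have e3 := Nat.mul_le_mul_right (s.card * 2) h₁
  have e4 := Nat.mul_le_mul_right (s.card * 2) h₂
  omega

end Sphere

/-! ### Sums of exponential weights along a sphere -/

/-- If the fibres of `p` have at most two elements, a sum of `φ ∘ p` is at most twice the sum of
`φ` over the values that `p` may take. -/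
theorem sum_comp_le_two_mul_tsum {β : Type*} (U : Finset β) (p : β → ℤ) {φ : ℤ → ℝ}
    (hφ : Summable φ) (h0 : ∀ t, 0 ≤ φ t) (s : Finset ℤ) (hs : ∀ u ∈ U, p u ∉ s)
    (hp : ∀ t, (U.filter fun u => p u = t).card ≤ 2) :
    ∑ u ∈ U, φ (p u) ≤ 2 * ∑' t : {t // t ∉ s}, φ t := by
  rw [Finset.sum_comp φ p]
  calc ∑ t ∈ U.image p, (U.filter fun u => p u = t).card • φ t
      ≤ ∑ t ∈ U.image p, 2 * (({t | t ∉ s} : Set ℤ).indicator φ t) := by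
        refine Finset.sum_le_sum fun t ht => ?_
        obtain ⟨u, hu, rfl⟩ := Finset.mem_image.1 ht
        rw [Set.indicator_of_mem (show p u ∈ {t | t ∉ s} from hs u hu), nsmul_eq_mul]
        exact mul_le_mul_of_nonneg_right (by exact_mod_cast hp (p u)) (h0 _)
    _ = 2 * ∑ t ∈ U.image p, (({t | t ∉ s} : Set ℤ).indicator φ t) := by rw [Finset.mul_sum]
    _ ≤ 2 * ∑' t, (({t | t ∉ s} : Set ℤ).indicator φ t) := by
        refine mul_le_mul_of_nonneg_left ((hφ.indicator _).sum_le_tsum _ fun t _ => ?_) (by norm_num)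
        exact Set.indicator_nonneg (fun t _ => h0 t) t
    _ = 2 * ∑' t : {t // t ∉ s}, φ t := by
        rw [← tsum_subtype]
        rfl

theorem summable_exp_neg_mul_natAbs {c : ℝ} (hc : 0 < c) :
    Summable fun t : ℤ => Real.exp (-c * t.natAbs) := by
  have h : Summable fun n : ℕ => Real.exp (-c * n) := by
    have := summable_geometric_of_lt_one (Real.exp_pos (-c)).le (by simpa using hc)
    refine this.congr fun n => ?_
    rw [← Real.exp_nat_mul, mul_comm]
  refine Summable.of_nat_of_neg ?_ ?_ <;> simpa using h

theorem tsum_exp_neg_mul_latticeDist {c : ℝ} (hc : 0 < c) (u : Vertex) :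
    ∑' w : Vertex, ENNReal.ofReal (Real.exp (-c * latticeDist u w)) =
      ENNReal.ofReal ((∑' t : ℤ, Real.exp (-c * t.natAbs)) ^ 2) := by
  have hs := summable_exp_neg_mul_natAbs hc
  have h1 : ∀ a : ℤ, ∑' t : ℤ, ENNReal.ofReal (Real.exp (-c * (a - t).natAbs)) =
      ENNReal.ofReal (∑' t : ℤ, Real.exp (-c * t.natAbs)) := fun a => by
    rw [ENNReal.ofReal_tsum_of_nonneg (fun _ => (Real.exp_pos _).le) hs]
    exact (Equiv.subLeft a).tsum_eq fun t : ℤ => ENNReal.ofReal (Real.exp (-c * t.natAbs))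
  rw [ENNReal.tsum_prod']
  have h2 : ∀ a b : ℤ, ENNReal.ofReal (Real.exp (-c * latticeDist u (a, b))) =
      ENNReal.ofReal (Real.exp (-c * (u.1 - a).natAbs)) *
        ENNReal.ofReal (Real.exp (-c * (u.2 - b).natAbs)) := fun a b => by
    rw [← ENNReal.ofReal_mul (Real.exp_pos _).le, ← Real.exp_add]
    simp only [latticeDist]
    push_cast
    ring_nf
  simp only [h2, ENNReal.tsum_mul_left, h1, ENNReal.tsum_mul_right]
  rw [sq, ENNReal.ofReal_mul (tsum_nonneg fun _ => (Real.exp_pos _).le)]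

theorem exists_sphere_card_mul_exp_le {c ε : ℝ} (hc : 0 < c) (hε : 0 < ε) :
    ∃ g₀ : ℕ, ∀ g ≥ g₀, ∀ R ≤ g ^ 2, ((2 * (R : ℝ) + 1) ^ 2) * Real.exp (-c * g) ≤ ε := by
  have h1 : Filter.Tendsto (fun g : ℕ => c * (g : ℝ)) Filter.atTop Filter.atTop :=
    tendsto_natCast_atTop_atTop.const_mul_atTop hc
  have h2 := ((Real.tendsto_pow_mul_exp_neg_atTop_nhds_zero 4).comp h1).const_mul (9 / c ^ 4)
  rw [mul_zero] at h2
  obtain ⟨g₀, hg₀⟩ := Filter.eventually_atTop.1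
    ((h2.eventually_lt_const hε).and (Filter.eventually_ge_atTop 1))
  refine ⟨g₀, fun g hg R hR => le_trans ?_ (hg₀ g hg).1.le⟩
  have hg1 : (1 : ℝ) ≤ g := by exact_mod_cast (hg₀ g hg).2
  have hR' : (R : ℝ) ≤ (g : ℝ) ^ 2 := by exact_mod_cast hR
  have h3 : 2 * (R : ℝ) + 1 ≤ 3 * (g : ℝ) ^ 2 := by nlinarith
  have h4 : 9 / c ^ 4 * ((c * (g : ℝ)) ^ 4 * Real.exp (-(c * g))) =
      (3 * (g : ℝ) ^ 2) ^ 2 * Real.exp (-c * g) := by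
    rw [neg_mul]
    field_simp
    ring
  simp only [Function.comp]
  rw [h4]
  gcongr

/-- On a sphere of radius at most `g ^ 2`, the vertices away from six given lines see the
complement of a region with a small total weight, if the complement is behind these lines or at
distance at least `g`. -/
theorem exists_sum_tsum_exp_le {C γ : ℝ} (hC : 0 < C) (hγ : 0 < γ) :
    ∃ (s : Finset ℤ) (g₀ : ℕ), ∀ g ≥ g₀, ∀ R ≤ g ^ 2, ∀ (y : Vertex) (A₁ A₂ : Finset ℤ)
      (Λ U : Finset Vertex), A₁.card ≤ 3 → A₂.card ≤ 3 → (∀ u ∈ U, latticeDist y u = R) →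
      (∀ u ∈ U, ∀ a ∈ A₁, u.1 - a ∉ s) → (∀ u ∈ U, ∀ a ∈ A₂, u.2 - a ∉ s) →
      (∀ u ∈ U, ∀ w, w ∉ Λ → g ≤ latticeDist u w ∨ (∃ a ∈ A₁, (u.1 - a).natAbs ≤ latticeDist u w) ∨
        ∃ a ∈ A₂, (u.2 - a).natAbs ≤ latticeDist u w) →
      ∑ u ∈ U, ∑' w : ((Λ : Set Vertex)ᶜ : Set Vertex),
        ENNReal.ofReal (C * Real.exp (-γ * (grid.dist u w : ℕ))) ≤ ENNReal.ofReal (1 / 2) := by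
  -- Half of the decay is summed over all `w`, giving `G`; the other half bounds the distance from
  -- `u` to the complement, giving `K u`.
  set c := γ / 2 with hc
  have hc0 : 0 < c := by positivity
  have hs := summable_exp_neg_mul_natAbs hc0
  have hφ0 : ∀ t : ℤ, 0 ≤ Real.exp (-c * t.natAbs) := fun t => (Real.exp_pos _).le
  set G := (∑' t : ℤ, Real.exp (-c * t.natAbs)) ^ 2 with hG
  have hG0 : 0 < G := pow_pos (hs.tsum_pos hφ0 0 (Real.exp_pos _)) 2
  have hCG : 0 < 48 * (C * G) := by positivity
  -- The inner ball contributes at most `1 / 4` to the total. So do the six lines: each counts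
  -- twice, with tail at most `1 / (48 * (C * G))`.
  obtain ⟨g₀, hg₀⟩ := exists_sphere_card_mul_exp_le hc0 (ε := 1 / (4 * (C * G))) (by positivity)
  have htail := tendsto_tsum_compl_atTop_zero fun t : ℤ => Real.exp (-c * t.natAbs)
  obtain ⟨s, hsε⟩ := (htail.eventually_lt_const (show 0 < 1 / (48 * (C * G)) by positivity)).exists
  refine ⟨s, g₀, fun g hg R hR y A₁ A₂ Λ U h₁ h₂ hU hs₁ hs₂ hΛ => ?_⟩
  let K : Vertex → ℝ := fun u => Real.exp (-c * g) +
    (∑ a ∈ A₁, Real.exp (-c * (u.1 - a).natAbs) + ∑ a ∈ A₂, Real.exp (-c * (u.2 - a).natAbs))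
  have hK1 : ∀ u : Vertex, 0 ≤ ∑ a ∈ A₁, Real.exp (-c * (u.1 - a).natAbs) := fun u =>
    Finset.sum_nonneg fun a _ => (Real.exp_pos _).le
  have hK2 : ∀ u : Vertex, 0 ≤ ∑ a ∈ A₂, Real.exp (-c * (u.2 - a).natAbs) := fun u =>
    Finset.sum_nonneg fun a _ => (Real.exp_pos _).le
  have hK0 : ∀ u, 0 ≤ K u := fun u =>
    add_nonneg (Real.exp_pos _).le (add_nonneg (hK1 u) (hK2 u))
  have hexp : ∀ {m n : ℕ}, m ≤ n → Real.exp (-c * n) ≤ Real.exp (-c * m) := fun {m n} h => by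
    have : (m : ℝ) ≤ n := by exact_mod_cast h
    refine Real.exp_le_exp.2 ?_
    nlinarith
  have hpt : ∀ u ∈ U, ∀ w, w ∉ Λ → C * Real.exp (-γ * (grid.dist u w : ℕ)) ≤
      C * K u * Real.exp (-c * latticeDist u w) := fun u hu w hw => by
    rw [mul_assoc]
    refine mul_le_mul_of_nonneg_left ?_ hC.le
    have e : Real.exp (-γ * (grid.dist u w : ℕ)) =
        Real.exp (-c * (grid.dist u w : ℕ)) * Real.exp (-c * (grid.dist u w : ℕ)) := by
      rw [← Real.exp_add, hc]
      ring_nf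
    have hd := hexp (latticeDist_le_dist u w)
    rw [e]
    refine mul_le_mul (hd.trans ?_) hd (Real.exp_pos _).le (hK0 u)
    rcases hΛ u hu w hw with h | ⟨a, ha, h⟩ | ⟨a, ha, h⟩
    · have := hexp h
      linarith [hK1 u, hK2 u]
    · have := hexp h
      have h' := Finset.single_le_sum (f := fun a => Real.exp (-c * (u.1 - a).natAbs))
        (fun a _ => (Real.exp_pos _).le) ha
      have h'' := Real.exp_pos (-c * g)
      linarith [hK1 u, hK2 u]
    · have := hexp h
      have h' := Finset.single_le_sum (f := fun a => Real.exp (-c * (u.2 - a).natAbs))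
        (fun a _ => (Real.exp_pos _).le) ha
      have h'' := Real.exp_pos (-c * g)
      linarith [hK1 u, hK2 u]
  have hin : ∀ u ∈ U, ∑' w : ((Λ : Set Vertex)ᶜ : Set Vertex),
      ENNReal.ofReal (C * Real.exp (-γ * (grid.dist u w : ℕ))) ≤
        ENNReal.ofReal (C * K u * G) := fun u hu => by
    have hCK : 0 ≤ C * K u := mul_nonneg hC.le (hK0 u)
    rw [ENNReal.ofReal_mul hCK, hG, ← tsum_exp_neg_mul_latticeDist hc0 u,
      ← ENNReal.tsum_mul_left]
    refine le_trans (ENNReal.tsum_le_tsum fun w => ?_)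
      (ENNReal.tsum_comp_le_tsum_of_injective Subtype.val_injective
        fun w => ENNReal.ofReal (C * K u) * ENNReal.ofReal (Real.exp (-c * latticeDist u w)))
    rw [← ENNReal.ofReal_mul hCK]
    exact ENNReal.ofReal_le_ofReal (hpt u hu w w.2)
  refine (Finset.sum_le_sum hin).trans ?_
  rw [← ENNReal.ofReal_sum_of_nonneg fun u _ => mul_nonneg (mul_nonneg hC.le (hK0 u)) hG0.le]
  refine ENNReal.ofReal_le_ofReal ?_
  have hT : ∀ (p : Vertex → ℤ) (A : Finset ℤ), A.card ≤ 3 → (∀ u ∈ U, ∀ a ∈ A, p u - a ∉ s) →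
      (∀ t, (U.filter fun u => p u = t).card ≤ 2) →
      ∑ u ∈ U, ∑ a ∈ A, Real.exp (-c * (p u - a).natAbs) ≤ 6 * (1 / (48 * (C * G))) := by
    intro p A hA hps hp
    rw [Finset.sum_comm]
    refine (Finset.sum_le_card_nsmul _ _ (2 * (1 / (48 * (C * G)))) fun a ha => ?_).trans ?_
    · refine (sum_comp_le_two_mul_tsum U (fun u => p u - a) hs hφ0 s (fun u hu => hps u hu a ha)
        fun t => ?_).trans (by linarith)
      simpa only [sub_eq_iff_eq_add] using hp (t + a)
    · rw [nsmul_eq_mul]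
      have hA' : (A.card : ℝ) ≤ 3 := by exact_mod_cast hA
      have : 0 < 1 / (48 * (C * G)) := by positivity
      nlinarith
  have hT1 := hT Prod.fst A₁ h₁ hs₁ (card_filter_fst_le hU)
  have hT2 := hT Prod.snd A₂ h₂ hs₂ (card_filter_snd_le hU)
  have hcard : ∑ u ∈ U, Real.exp (-c * g) ≤ 1 / (4 * (C * G)) := by
    rw [Finset.sum_const, nsmul_eq_mul]
    refine le_trans (mul_le_mul_of_nonneg_right ?_ (Real.exp_pos _).le) (hg₀ g hg R hR)
    exact_mod_cast card_le_of_sphere hU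
  have hKsum : ∑ u ∈ U, K u ≤ 1 / (4 * (C * G)) + 12 * (1 / (48 * (C * G))) := by
    simp only [K, Finset.sum_add_distrib]
    linarith
  calc ∑ u ∈ U, C * K u * G = C * G * ∑ u ∈ U, K u := by
        rw [Finset.mul_sum]
        exact Finset.sum_congr rfl fun _ _ => by ring
    _ ≤ C * G * (1 / (4 * (C * G)) + 12 * (1 / (48 * (C * G)))) :=
        mul_le_mul_of_nonneg_left hKsum (by positivity)
    _ = 1 / 2 := by
        field_simp
        norm_num

end GridSpin

/-! ### Contraction across one annulus, and its iteration -/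

namespace SpinSystem

variable {q : ℕ}

theorem IsPositive.feasible {M : SpinSystem q} {σ : Config q} (h : M.IsPositive σ)
    (T : Set Vertex) : M.Feasible T σ :=
  ⟨σ, Set.eqOn_refl _ _, h⟩

theorem exists_forall_mem_Icc_of_sub_le {α : Type*} {S : Set α} (hS : S.Nonempty) {h : α → ℝ}
    {s : ℝ} (hs : ∀ x ∈ S, ∀ x' ∈ S, h x - h x' ≤ s) :
    ∃ m, ∀ x ∈ S, m ≤ h x ∧ h x ≤ m + s := by
  obtain ⟨x₀, hx₀⟩ := hS
  have hb : BddBelow (h '' S) := ⟨h x₀ - s, by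
    rintro _ ⟨x, hx, rfl⟩
    linarith [hs x₀ hx₀ x hx]⟩
  refine ⟨sInf (h '' S), fun x hx => ⟨csInf_le hb ⟨x, hx, rfl⟩, ?_⟩⟩
  have : h x - s ≤ sInf (h '' S) := by
    refine le_csInf ⟨_, x₀, hx₀, rfl⟩ ?_
    rintro _ ⟨x', hx', rfl⟩
    linarith [hs x hx x' hx']
  linarith

/-- Under weak spatial mixing, in a soft system, the influence of the boundary condition on an
arc of a sphere at distance at least `g` from all but six lines of the fixed vertices is
contracted by a constant factor. -/
theorem exists_arc_contraction (M : SpinSystem q) (hsoft : M.IsSoft) {C γ : ℝ} (hC : 0 < C)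
    (hγ : 0 < γ) (hwsm : M.WeakSpatialMixing fun n => C * Real.exp (-γ * n)) :
    ∃ (δ : ℝ) (g₀ : ℕ), 0 < δ ∧ δ ≤ 1 ∧ ∀ g ≥ g₀, ∀ R ≤ g ^ 2, ∀ (y : Vertex)
      (A₁ A₂ : Finset ℤ) (Λ arc : Finset Vertex), A₁.card ≤ 3 → A₂.card ≤ 3 → arc ⊆ Λ →
      (∀ u ∈ arc, latticeDist y u = R) →
      (∀ u ∈ arc, ∀ w, w ∉ Λ → g ≤ latticeDist u w ∨
        (∃ a ∈ A₁, (u.1 - a).natAbs ≤ latticeDist u w) ∨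
          ∃ a ∈ A₂, (u.2 - a).natAbs ≤ latticeDist u w) →
      ∀ 𝒞 : Set (Config q), (∀ σ ∈ 𝒞, M.IsPositive σ) →
      (∀ η ∈ 𝒞, ∀ σ, M.IsPositive σ → (∀ v, v ∉ Λ → σ v = η v) → σ ∈ 𝒞) →
      ∀ (h : Config q → ℝ) (s : ℝ),
      (∀ σ ∈ 𝒞, ∀ σ' ∈ 𝒞, (∀ v ∈ arc, σ v = σ' v) → h σ = h σ') →
      (∀ σ ∈ 𝒞, ∀ σ' ∈ 𝒞, h σ - h σ' ≤ s) →
      ∀ η ∈ 𝒞, ∀ η' ∈ 𝒞, M.expect Λ η h - M.expect Λ η' h ≤ (1 - δ) * s := by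
  classical
  obtain ⟨α, hα, i, hb, hA⟩ := hsoft
  obtain ⟨Z, g₀, hZ⟩ := exists_sum_tsum_exp_le hC hγ
  -- `Z` depends only on `C` and `γ`, so `ε` is uniform in `g`, `R` and the region.
  obtain ⟨ε, hε0, hε1, hε⟩ := exists_le_expect_of_soft M hα hb hA (12 * Z.card)
  refine ⟨ε / 2, g₀, by positivity, by linarith, ?_⟩
  intro g hg R hR y A₁ A₂ Λ arc h₁ h₂ harc hsph hΛ 𝒞 hpos hcl h s hloc hosc η hη η' hη'
  have hs0 : 0 ≤ s := by simpa using hosc η hη η hη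
  by_cases heq : Set.EqOn η η' ((Λ : Set Vertex)ᶜ)
  · have e : M.expect Λ η h = M.expect Λ η' h :=
      expect_congr_boundary (fun v hv => heq hv.1) fun ξ => by rw [glue_congr fun v hv => heq hv]
    rw [e, sub_self]
    exact mul_nonneg (by linarith) hs0
  obtain ⟨m, hm⟩ := exists_forall_mem_Icc_of_sub_le ⟨η, hη⟩ hosc
  set V := nearLines Z A₁ A₂ arc with hV
  have hVarc : V ⊆ arc := Finset.filter_subset _ _
  have hVΛ : V ⊆ Λ := hVarc.trans harc
  have hVcard : V.card ≤ 12 * Z.card := card_nearLines_le hsph Z h₁ h₂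
  set U := arc \ V with hU
  have hset : ∀ σ ∈ 𝒞, setSpins V i σ ∈ 𝒞 := fun σ hσ =>
    hcl σ hσ _ ((hpos σ hσ).setSpins hb (fun j => hα.trans (hA j)) V) fun v hv =>
      glue_of_notMem _ _ fun hv' => hv (hVΛ hv')
  -- With the soft spin forced on `V`, the observable depends on the spins in `U` only, where weak
  -- mixing gives distance at most `1 / 2`.
  set k : Config q → ℝ := fun σ => h (setSpins V i σ) with hk
  have hkloc : ∀ σ ∈ 𝒞, ∀ σ' ∈ 𝒞, restrictTo U σ = restrictTo U σ' → k σ = k σ' := by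
    intro σ hσ σ' hσ' hr
    refine hloc _ (hset σ hσ) _ (hset σ' hσ') fun v hv => ?_
    by_cases hvV : v ∈ V
    · simp only [setSpins, glue_of_mem _ _ hvV]
    · simp only [setSpins, glue_of_notMem _ _ hvV]
      exact congrFun hr ⟨v, Finset.mem_sdiff.2 ⟨hv, hvV⟩⟩
  -- The default `m` keeps `F` within `[m, m + s]`.
  let F : (U → Fin q) → ℝ := fun ρ =>
    if H : ∃ σ ∈ 𝒞, restrictTo U σ = ρ then k H.choose else m
  have hF : ∀ σ ∈ 𝒞, k σ = F (restrictTo U σ) := by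
    intro σ hσ
    have H : ∃ σ' ∈ 𝒞, restrictTo U σ' = restrictTo U σ := ⟨σ, hσ, rfl⟩
    simp only [F, dif_pos H]
    exact hkloc _ hσ _ H.choose_spec.1 H.choose_spec.2.symm
  have hFm : ∀ ρ, m ≤ F ρ ∧ F ρ ≤ m + s := by
    intro ρ
    simp only [F]
    split_ifs with H
    · exact hm _ (hset _ H.choose_spec.1)
    · exact ⟨le_rfl, by linarith⟩
  have hEk : ∀ ω ∈ 𝒞, M.expect Λ ω k = ∑ ρ, F ρ * M.marginal Λ ω U ρ := by
    intro ω hω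
    rw [← expect_comp_restrictTo]
    exact expect_congr (hpos ω hω) fun σ hσ hσω => hF σ (hcl ω hω σ hσ hσω)
  have htv : tv (M.marginal Λ η U) (M.marginal Λ η' U) ≤ 1 / 2 := by
    have h1 := hwsm Λ U (Finset.sdiff_subset.trans harc) η η' ((hpos η hη).feasible _)
      ((hpos η' hη').feasible _) heq
    have hnear : ∀ u ∈ U, (∀ a ∈ A₁, u.1 - a ∉ Z) ∧ ∀ a ∈ A₂, u.2 - a ∉ Z := by
      intro u hu
      obtain ⟨hu1, hu2⟩ := Finset.mem_sdiff.1 hu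
      exact ⟨fun a ha hz => hu2 (Finset.mem_filter.2 ⟨hu1, Or.inl ⟨a, ha, hz⟩⟩),
        fun a ha hz => hu2 (Finset.mem_filter.2 ⟨hu1, Or.inr ⟨a, ha, hz⟩⟩)⟩
    have h2 := hZ g hg R hR y A₁ A₂ Λ U h₁ h₂ (fun u hu => hsph u (Finset.mem_sdiff.1 hu).1)
      (fun u hu => (hnear u hu).1) (fun u hu => (hnear u hu).2)
      fun u hu => hΛ u (Finset.mem_sdiff.1 hu).1
    exact (ENNReal.ofReal_le_ofReal_iff (by norm_num)).1 (h1.trans h2)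
  have hkdiff : M.expect Λ η k - M.expect Λ η' k ≤ s / 2 := by
    rw [hEk η hη, hEk η' hη']
    refine (sum_mul_sub_le_tv ((sum_marginal (hpos η hη) U).trans
      (sum_marginal (hpos η' hη') U).symm) (fun ρ => (hFm ρ).1) fun ρ => (hFm ρ).2).trans ?_
    nlinarith
  -- Softness needs nonnegative observables, hence `m + s - h` under `η` and `h - m` under `η'`.
  -- Adding the two bounds gains at least `ε * (s - s / 2)`.
  have hup := hε Λ V η (fun σ => m + s - h σ) (hpos η hη) hVΛ hVcard fun σ hσ hση => by
    linarith [(hm σ (hcl η hη σ hσ hση)).2]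
  have hlo := hε Λ V η' (fun σ => h σ - m) (hpos η' hη') hVΛ hVcard fun σ hσ hση => by
    linarith [(hm σ (hcl η' hη' σ hσ hση)).1]
  rw [expect_sub, expect_sub, expect_const (hpos η hη)] at hup
  rw [expect_sub, expect_sub, expect_const (hpos η' hη')] at hlo
  change ε * (m + s - M.expect Λ η k) ≤ _ at hup
  change ε * (M.expect Λ η' k - m) ≤ _ at hlo
  nlinarith

/-- The influence of the spin at `y` decays exponentially in the number of concentric
annuli of width `g` around `y`, in a region whose complement lies behind six lines. -/
theorem exists_influence_le (M : SpinSystem q) (hsoft : M.IsSoft) {C γ : ℝ} (hC : 0 < C)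
    (hγ : 0 < γ) (hwsm : M.WeakSpatialMixing fun n => C * Real.exp (-γ * n)) :
    ∃ (δ : ℝ) (g₀ : ℕ), 0 < δ ∧ δ ≤ 1 ∧ 1 ≤ g₀ ∧ ∀ g ≥ g₀, ∀ (y : Vertex) (A₁ A₂ : Finset ℤ)
      (Λ T Q : Finset Vertex), A₁.card ≤ 3 → A₂.card ≤ 3 →
      (∀ u ∈ Λ, ∀ w, w ∉ Λ → (∃ a ∈ A₁, (u.1 - a).natAbs ≤ latticeDist u w) ∨
          ∃ a ∈ A₂, (u.2 - a).natAbs ≤ latticeDist u w) →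
      boundary Λ ⊆ (T : Set Vertex) → Disjoint Λ T → y ∉ Λ →
      (∀ v ∈ Q, g ^ 2 ≤ latticeDist y v ∧ (v ∈ Λ ∨ v ∈ T ∧ v ≠ y)) →
      ∀ η η' : Config q, M.IsPositive η → M.IsPositive η' → (∀ v ∈ T, v ≠ y → η v = η' v) →
      tv (M.marginal Λ η Q) (M.marginal Λ η' Q) ≤ (1 - δ) ^ g := by
  obtain ⟨δ, g₀, hδ0, hδ1, H⟩ := exists_arc_contraction M hsoft hC hγ hwsm
  refine ⟨δ, max g₀ 1, hδ0, hδ1, le_max_right _ _, ?_⟩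
  intro g hg y A₁ A₂ Λ T Q h₁ h₂ hΛ hbd hdisj hy hQ η η' hη hη' hηη'
  have hg₀ : g₀ ≤ g := (le_max_left _ _).trans hg
  have hg1 : 1 ≤ g := (le_max_right _ _).trans hg
  let 𝒞 : Set (Config q) := {σ | M.IsPositive σ ∧ ∀ v ∈ T, v ≠ y → σ v = η v}
  let Λ' : ℕ → Finset Vertex := fun k => Λ.filter fun v => k * g < latticeDist y v
  have hΛ' : ∀ k v, v ∈ Λ' k ↔ v ∈ Λ ∧ k * g < latticeDist y v := fun k v =>
    Finset.mem_filter
  -- `j` annuli remain beyond radius `k * g`. Inside, `ω` and `ω'` may differ arbitrarily on `Λ`.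
  have key : ∀ f : Config q → ℝ, (∀ σ, 0 ≤ f σ) → (∀ σ, f σ ≤ 1) →
      (∀ σ σ', (∀ v ∈ Q, σ v = σ' v) → f σ = f σ') → ∀ j k, k + j = g → ∀ ω ∈ 𝒞, ∀ ω' ∈ 𝒞,
        M.expect (Λ' k) ω f - M.expect (Λ' k) ω' f ≤ (1 - δ) ^ j := by
    intro f hf0 hf1 hfQ j
    induction j with
    | zero =>
      intro k _ ω hω ω' hω'
      have e1 := expect_mono (Λ := Λ' k) (f := f) (g := fun _ => 1) hω.1 fun σ _ _ => hf1 σ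
      have e2 := expect_mono (Λ := Λ' k) (f := fun _ => 0) (g := f) hω'.1 fun σ _ _ => hf0 σ
      rw [expect_const hω.1] at e1
      rw [expect_const hω'.1] at e2
      rw [pow_zero]
      linarith
    | succ j ih =>
      intro k hk ω hω ω' hω'
      have hsucc : (k + 1) * g = k * g + g := by ring
      have hle : (k + 1) * g ≤ g ^ 2 := by
        rw [sq]
        exact Nat.mul_le_mul_right g (by omega)
      have hsub : Λ' (k + 1) ⊆ Λ' k := fun v hv => by
        rw [hΛ'] at hv ⊢
        exact ⟨hv.1, by omega⟩
      rw [← expect_expect hω.1 hsub f, ← expect_expect hω'.1 hsub f, pow_succ']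
      refine H g hg₀ ((k + 1) * g) hle y A₁ A₂ (Λ' k)
        (Λ.filter fun v => latticeDist y v = (k + 1) * g) h₁ h₂ ?_ ?_ ?_ 𝒞 (fun σ hσ => hσ.1) ?_
        _ _ ?_ (ih (k + 1) (by omega)) ω hω ω' hω'
      · intro v hv
        obtain ⟨hvΛ, hvd⟩ := Finset.mem_filter.1 hv
        rw [hΛ']
        exact ⟨hvΛ, by omega⟩
      · exact fun u hu => (Finset.mem_filter.1 hu).2
      · intro u hu w hw
        obtain ⟨huΛ, hud⟩ := Finset.mem_filter.1 hu
        by_cases hwΛ : w ∈ Λ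
        · left
          have hwd : latticeDist y w ≤ k * g := by
            by_contra hcon
            exact hw ((hΛ' k w).2 ⟨hwΛ, by omega⟩)
          rw [hsucc] at hud
          simp only [latticeDist] at hud hwd ⊢
          omega
        · exact Or.inr (hΛ u huΛ w hwΛ)
      · intro ζ hζ σ hσ hσζ
        refine ⟨hσ, fun v hv hvy => ?_⟩
        rw [hσζ v fun h => Finset.disjoint_left.1 hdisj ((hΛ' k v).1 h).1 hv]
        exact hζ.2 v hv hvy
      · intro σ hσ σ' hσ' harc
        refine expect_congr_boundary (fun v hv => ?_) fun ξ => hfQ _ _ fun v hv => ?_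
        · obtain ⟨hv1, u, hu, huv⟩ := hv
          have hv1' : v ∉ Λ' (k + 1) := hv1
          have hu' := (hΛ' _ _).1 (Finset.mem_coe.1 hu)
          have hd := latticeDist_le_add_one_of_adj y huv.symm
          by_cases hvΛ : v ∈ Λ
          · refine harc v (Finset.mem_filter.2 ⟨hvΛ, ?_⟩)
            have : ¬ (k + 1) * g < latticeDist y v := fun h => hv1' ((hΛ' _ _).2 ⟨hvΛ, h⟩)
            omega
          · have hvT : v ∈ T := hbd ⟨hvΛ, u, hu'.1, huv⟩
            -- The neighbour `u` of `v` is farther than `(k + 1) * g ≥ 1` from `y`; this uses `1 ≤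
            -- g`.
            have hvy : v ≠ y := by
              rintro rfl
              have : latticeDist v v = 0 := by simp [latticeDist]
              omega
            rw [hσ.2 v hvT hvy, hσ'.2 v hvT hvy]
        · by_cases hvΛ' : v ∈ Λ' (k + 1)
          · rw [glue_of_mem _ _ hvΛ', glue_of_mem _ _ hvΛ']
          · rw [glue_of_notMem _ _ hvΛ', glue_of_notMem _ _ hvΛ']
            obtain ⟨hd, hvΛ | ⟨hvT, hvy⟩⟩ := hQ v hv
            -- Here `v` is at distance at least `g ^ 2 ≥ (k + 1) * g` but not beyond the sphere,
            -- hence on the arc.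
            · refine harc v (Finset.mem_filter.2 ⟨hvΛ, ?_⟩)
              have : ¬ (k + 1) * g < latticeDist y v := fun h => hvΛ' ((hΛ' _ _).2 ⟨hvΛ, h⟩)
              omega
            · rw [hσ.2 v hvT hvy, hσ'.2 v hvT hvy]
  have hΛ0 : Λ' 0 = Λ := Finset.filter_true_of_mem fun v hv => by
    have hne : v ≠ y := by rintro rfl; exact hy hv
    rw [zero_mul]
    by_contra h0
    refine hne (Prod.ext ?_ ?_) <;> simp only [latticeDist] at h0 <;> omega
  refine tv_le_of_forall ((sum_marginal hη Q).trans (sum_marginal hη' Q).symm)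
    fun F hF0 hF1 => ?_
  rw [← expect_comp_restrictTo, ← expect_comp_restrictTo]
  have := key (fun σ => F (restrictTo Q σ)) (fun _ => hF0 _) (fun _ => hF1 _)
    (fun σ σ' h => by
      have : restrictTo Q σ = restrictTo Q σ' := funext fun v => h v v.2
      simp only [this]) g 0 (zero_add g) η ⟨hη, fun _ _ _ => rfl⟩ η'
    ⟨hη', fun v hv hvy => (hηη' v hv hvy).symm⟩
  rwa [hΛ0] at this

theorem marginal_congr {M : SpinSystem q} {Λ U : Finset Vertex} {η η' : Config q}
    (h : ∀ v ∈ boundary Λ, η v = η' v) (hU : ∀ v ∈ U, v ∉ Λ → η v = η' v) :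
    M.marginal Λ η U = M.marginal Λ η' U := by
  funext ρ
  rw [marginal_eq_expect, marginal_eq_expect]
  refine expect_congr_boundary h fun ξ => ?_
  have : restrictTo U (glue Λ ξ η) = restrictTo U (glue Λ ξ η') := by
    funext v
    by_cases hv : (v : Vertex) ∈ Λ
    · simp only [restrictTo, glue_of_mem _ _ hv]
    · simp only [restrictTo, glue_of_notMem _ _ hv, hU v v.2 hv]
  rw [this]

end SpinSystem

/-! ### The bisected square and the conclusion -/

namespace GridSpin

theorem mem_square {c v : Vertex} {n : ℕ} :
    v ∈ square c n ↔ (c.1 < v.1 ∧ v.1 < c.1 + n) ∧ c.2 < v.2 ∧ v.2 < c.2 + n := by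
  simp [square]

/-- Inside the square, its bisected boundary consists of points of the bisecting lines. -/
theorem eq_or_eq_of_mem_bisectedBoundary {c w : Vertex} {L : ℕ} (hw : w ∈ bisectedBoundary c L)
    (hS : w ∈ square c (2 * L)) : w.1 = c.1 + L ∨ w.2 = c.2 + L := by
  obtain ⟨a, b⟩ := w
  rw [mem_square] at hS
  push_cast at hS
  rcases hw with (h | ((h | h) | h) | h) | h
  · exact absurd (mem_square.2 (by push_cast; exact hS)) h.1
  iterate 4
    obtain ⟨h1, u, hu, huv⟩ := h
    simp only [Finset.mem_coe, mem_square] at h1 hu hS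
    rcases (grid_adj_iff _ _).1 huv with h | h | h | h <;> simp only [Prod.mk.injEq] at h <;> omega
  · simp only [Set.mem_singleton_iff, Prod.mk.injEq] at h
    exact Or.inl h.1

end GridSpin

end

open GridSpin
theorem proposition3p2 {q : ℕ} (M : SpinSystem q) (hsoft : M.IsSoft)
    (C γ : ℝ) (hC : 0 < C) (hγ : 0 < γ)
    (hwsm : M.WeakSpatialMixing fun n => C * Real.exp (-γ * n)) :
    ∃ (L₀ : ℕ) (γ₀ : ℝ), 0 < γ₀ ∧
      ∀ L : ℕ, L₀ < L → ∀ c : Vertex,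
      ∀ y ∈ boundary (square c (2 * L)),
      ∀ T : Finset Vertex, boundary (square c (2 * L)) ⊆ (T : Set Vertex) →
        (T : Set Vertex) ⊆ bisectedBoundary c L →
      ∀ τ τ' : Config q, M.Feasible (T : Set Vertex) τ → M.Feasible (T : Set Vertex) τ' →
        (∀ v ∈ T, v ≠ y → τ v = τ' v) →
        SpinSystem.tv (M.marginal (square c (2 * L) \ T) τ (farPart c L y))
            (M.marginal (square c (2 * L) \ T) τ' (farPart c L y)) ≤
          Real.exp (-γ₀ * (L : ℝ) ^ (1 / 4 : ℝ)) := by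
  obtain ⟨δ, g₀, hδ0, hδ1, hg₀, H⟩ := M.exists_influence_le hsoft hC hγ hwsm
  -- `L > g₀ ^ 4` makes `⌊L^{1/4}⌋ ≥ g₀`; halving `δ` pays for the floor, as `x ≤ 2 * ⌊x⌋` once `⌊x⌋
  -- ≥ 1`.
  refine ⟨g₀ ^ 4, δ / 2, by positivity, ?_⟩
  intro L hL c y hy T hT₁ hT₂ τ τ' ⟨σ, hστ, hσ⟩ ⟨σ', hστ', hσ'⟩ hττ'
  set S := square c (2 * L) with hS
  set x : ℝ := (L : ℝ) ^ (1 / 4 : ℝ) with hx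
  have hx0 : 0 ≤ x := by positivity
  have hxg : (g₀ : ℝ) ≤ x := by
    have h1 : ((g₀ : ℝ) ^ 4) ≤ L := by exact_mod_cast hL.le
    have h2 := Real.rpow_le_rpow (by positivity) h1 (show (0 : ℝ) ≤ 1 / 4 by norm_num)
    refine le_trans (le_of_eq ?_) h2
    rw [← Real.rpow_natCast, ← Real.rpow_mul (by positivity)]
    norm_num
  have hx2 : x ^ 2 = (L : ℝ) ^ (1 / 2 : ℝ) := by
    rw [hx, ← Real.rpow_natCast, ← Real.rpow_mul (by positivity)]
    norm_num
  have hgx : (⌊x⌋₊ : ℝ) ≤ x := Nat.floor_le hx0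
  have hyS : y ∉ S := hy.1
  have hbd : boundary ((S \ T : Finset Vertex) : Set Vertex) ⊆ (T : Set Vertex) := by
    rintro v ⟨hv, u, hu, huv⟩
    by_cases hvS : v ∈ S
    · by_contra hvT
      exact hv (Finset.mem_coe.2 (Finset.mem_sdiff.2 ⟨hvS, hvT⟩))
    · exact hT₁ ⟨hvS, u, (Finset.mem_sdiff.1 (Finset.mem_coe.1 hu)).1, huv⟩
  have hfar : ∀ v ∈ farPart c L y, v ∉ S \ T → v ∈ T := fun v hv hv' => by
    by_contra hvT
    exact hv' (Finset.mem_sdiff.2 ⟨(Finset.mem_filter.1 hv).1, hvT⟩)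
  -- Off `T` the values of `τ` and `τ'` are arbitrary, so the positive extensions `σ` and `σ'` take
  -- their place.
  rw [← SpinSystem.marginal_congr (fun v hv => hστ (hbd hv)) fun v hv hv' => hστ (hfar v hv hv'),
    ← SpinSystem.marginal_congr (fun v hv => hστ' (hbd hv)) fun v hv hv' => hστ' (hfar v hv hv')]
  refine (H ⌊x⌋₊ (Nat.le_floor hxg) y {c.1, c.1 + L, c.1 + 2 * L} {c.2, c.2 + L, c.2 + 2 * L}
    (S \ T) T (farPart c L y) Finset.card_le_three Finset.card_le_three ?_ hbd
    Finset.sdiff_disjoint (fun h => hyS (Finset.mem_sdiff.1 h).1) ?_ σ σ' hσ hσ' ?_).trans ?_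
  · intro u hu w hw
    have huS := mem_square.1 (Finset.mem_sdiff.1 hu).1
    push_cast at huS
    have hline : ((w.1 ≤ c.1 ∨ c.1 + 2 * L ≤ w.1) ∨ w.1 = c.1 + L) ∨
        ((w.2 ≤ c.2 ∨ c.2 + 2 * L ≤ w.2) ∨ w.2 = c.2 + L) := by
      by_cases hwS : w ∈ S
      · have hwT : w ∈ T := by
          by_contra hwT
          exact hw (Finset.mem_sdiff.2 ⟨hwS, hwT⟩)
        have := eq_or_eq_of_mem_bisectedBoundary (hT₂ hwT) hwS
        tauto
      · rw [hS, mem_square] at hwS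
        push_cast at hwS
        omega
    simp only [Finset.mem_insert, Finset.mem_singleton, exists_eq_or_imp, exists_eq_left,
      latticeDist]
    omega
  · intro v hv
    obtain ⟨hvS, hvy⟩ := Finset.mem_filter.1 hv
    refine ⟨?_, ?_⟩
    · have h1 : latticeDist y v = latticeDist v y := by
        simp only [latticeDist]
        omega
      have h2 := hvy.trans (euclDist_le_latticeDist v y)
      rw [← hx2, ← h1] at h2
      have h3 : (⌊x⌋₊ : ℝ) ^ 2 ≤ x ^ 2 := by gcongr
      exact_mod_cast h3.trans h2
    · by_cases hvT : v ∈ T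
      · exact Or.inr ⟨hvT, by rintro rfl; exact hyS hvS⟩
      · exact Or.inl (Finset.mem_sdiff.2 ⟨hvS, hvT⟩)
  · intro v hv hvy
    rw [hστ hv, hστ' hv, hττ' v hv hvy]
  · have h1 : (1 - δ) ^ ⌊x⌋₊ ≤ Real.exp (-δ) ^ ⌊x⌋₊ :=
      pow_le_pow_left₀ (by linarith) (by linarith [Real.add_one_le_exp (-δ)]) _
    refine h1.trans ?_
    rw [← Real.exp_nat_mul]
    refine Real.exp_le_exp.2 ?_
    have h2 := Nat.lt_floor_add_one x
    have h3 : (1 : ℝ) ≤ ⌊x⌋₊ := by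
      have : 1 ≤ ⌊x⌋₊ := hg₀.trans (Nat.le_floor hxg)
      exact_mod_cast this
    nlinarith
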